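/- Let $n,k\ge 1$. A weighted partition of $[n]=\{1,\dots,n\}$ with $k$ layers consists of $k$ layers, each a set of non-empty pairwise disjoint subsets (blocks) of $[n]$, such that the blocks of the first layer cover $[n]$, each block of a layer is contained in a block of every earlier layer, and every block of the layers $2,\dots,k$ has at least two elements (these layers need not cover $[n]$ and may be empty). The set of weighted partitions is $\mathcal P_n^{(k)}$, and $\mathcal P_n^{(k)}(r)$ is the set of those with exactly $r$ blocks in the first layer. For $\pi\in\mathcal P_n^{(k)}$, $i\in[n]$ and $1\le l\le k$, let $B^{(l)}(i)$ be the block of the $l$-th layer of $\pi$ that contains $i$, or $\{i\}$ if there is none. Say that $\pi'$ covers $\pi$, written $\pi\lessdot\pi'$, if there are $1\le\alpha<\beta\le n$ and $1\le l\le k$ such that (a) $B^{(1)}(\alpha)\ne B^{(1)}(\beta)$ and $\beta=\min B^{(1)}(\beta)$; (b) $B^{(l)}(\alpha)\neq B^{(l)}(\beta)$, $\alpha=\min B^{(l)}(\alpha)$ and $\beta=\min B^{(l)}(\beta)$; and $\pi'$ is obtained from $\pi$ by replacing, in each layer $l'\le l$, the blocks $B^{(l')}(\alpha)$ and $B^{(l')}(\beta)$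 by their union, leaving the layers $l'>l$ unchanged. Order $\mathcal P_n^{(k)}$ by the reflexive transitive closure $\le$ of $\lessdot$, and let $\hat 0=1/2/\cdots/n$ be the weighted partition whose first-layer blocks are all singletons and whose other layers are empty. Let $\mu$ be the Möbius function of this finite poset, $\mu(x,x)=1$ and $\mu(x,y)=-\sum_{x\le z<y}\mu(x,z)$ for $x<y$. Define the Whitney numbers of the first kind and the characteristic polynomial by $$w_r^{(n,k)}:=\sum_{\pi\in\mathcal P_n^{(k)}(r)}\mu(\hat 0,\pi),\qquad P_n^{(k)}(x):=\sum_{r=1}^{n}w_r^{(n,k)}x^r .$$ Then $$P_n^{(k)}(x)=\prod_{j=0}^{n-1}(x-kj),$$ and hence $w_r^{(n,k)}=k^{\,n-r}s(n,r)$ for $1\le r\le n$, where $s(n,r)$ is the signed Stirling number of the first kind, defined by $x(x-1)\cdots(x-n+1)=\sum_{r=0}^{n}s(n,r)x^r$. -/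

import Mathlib

open Finset Polynomial

/-- A weighted partition of an `n`-element linearly ordered set (here `Fin n`, standing for
`{1 < 2 < ⋯ < n}`) with `k ≥ 1` layers; the layers are numbered `0, …, k - 1`, so the first layer
has index `0`.  Each layer is a set of non-empty pairwise disjoint blocks.  The first layer is a
partition of the whole ground set, every block of a deeper layer lies inside a block of each
earlier layer, and the blocks of the layers after the first have at least two elements (elements
that are not covered by a deeper layer are allowed, and such a layer may be empty). -/
@[ext]
structure WeightedPartition (n k : ℕ) [NeZero k] where
  layer : Fin k → Finset (Finset (Fin n))
  block_nonempty : ∀ l, ∀ B ∈ layer l, B.Nonempty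
  block_disjoint : ∀ l, ∀ B ∈ layer l, ∀ C ∈ layer l, B ≠ C → Disjoint B C
  first_covers : ∀ i, ∃ B ∈ layer 0, i ∈ B
  two_le_card : ∀ l, l ≠ 0 → ∀ B ∈ layer l, 2 ≤ B.card
  refines : ∀ l l', l ≤ l' → ∀ B ∈ layer l', ∃ C ∈ layer l, B ⊆ C

namespace WeightedPartition

variable {n k : ℕ} [NeZero k]

/-- The number of blocks of a weighted partition (the blocks of its first layer). -/
def numBlocks (x : WeightedPartition n k) : ℕ := (x.layer 0).card

/-- The block of `i` in the `l`-th layer, viewed as a partition of the whole ground set: the block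
of the `l`-th layer that contains `i`, or the singleton `{i}` if there is none. -/
def blockOf (x : WeightedPartition n k) (l : Fin k) (i : Fin n) : Finset (Fin n) :=
  Finset.univ.filter fun j => j = i ∨ ∃ B ∈ x.layer l, i ∈ B ∧ j ∈ B

/-- The label `(a, b)` in layer `l` is admissible for `x`: `a < b`; the points `a` and `b` lie in
different blocks of the first layer and `b` is the least element of its block there; and in the
`l`-th layer `a` and `b` lie in different blocks, each being the least element of its block. -/
def Admissible (x : WeightedPartition n k) (a b : Fin n) (l : Fin k) : Prop :=
  a < b ∧
    (x.blockOf 0 a ≠ x.blockOf 0 b ∧ ∀ j ∈ x.blockOf 0 b, b ≤ j) ∧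
    (x.blockOf l a ≠ x.blockOf l b ∧
      (∀ j ∈ x.blockOf l a, a ≤ j) ∧ ∀ j ∈ x.blockOf l b, b ≤ j)

/-- `y` covers `x`: for some admissible label `(a, b)` in layer `l`, `y` is obtained from `x` by
merging the block of `a` with the block of `b` in each of the layers up to the `l`-th one and
leaving the deeper layers unchanged. -/
def Cover (x y : WeightedPartition n k) : Prop :=
  ∃ (a b : Fin n) (l : Fin k), x.Admissible a b l ∧
    ∀ l', y.layer l' =
      if l' ≤ l then
        insert (x.blockOf l' a ∪ x.blockOf l' b)
          (((x.layer l').erase (x.blockOf l' a)).erase (x.blockOf l' b))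
      else x.layer l'

theorem blockOf_zero_mem (x : WeightedPartition n k) (i : Fin n) : x.blockOf 0 i ∈ x.layer 0 := by
  obtain ⟨B, hB, hi⟩ := x.first_covers i
  have h : x.blockOf 0 i = B := by
    ext j
    simp only [blockOf, mem_filter, mem_univ, true_and]
    constructor
    · rintro (rfl | ⟨C, hC, hiC, hjC⟩)
      · exact hi
      · by_contra hj
        have hne : B ≠ C := fun h => hj (h ▸ hjC)
        exact Finset.disjoint_left.1 (x.block_disjoint 0 B hB C hC hne) hi hiC
    · intro hj
      exact Or.inr ⟨B, hB, hi, hj⟩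
  rw [h]
  exact hB

theorem Cover.numBlocks_lt {x y : WeightedPartition n k} (h : Cover x y) :
    y.numBlocks < x.numBlocks := by
  obtain ⟨a, b, l, hadm, hy⟩ := h
  have hne := hadm.2.1.1
  have ha := x.blockOf_zero_mem a
  have hb := x.blockOf_zero_mem b
  have h0 := hy 0
  rw [if_pos (Fin.zero_le l)] at h0
  have hb' : x.blockOf 0 b ∈ (x.layer 0).erase (x.blockOf 0 a) :=
    mem_erase.2 ⟨hne.symm, hb⟩
  have h1 := card_erase_add_one ha
  have h2 := card_erase_add_one hb'
  have h3 := card_insert_le (x.blockOf 0 a ∪ x.blockOf 0 b)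
    (((x.layer 0).erase (x.blockOf 0 a)).erase (x.blockOf 0 b))
  unfold numBlocks
  rw [h0]
  omega

theorem eq_or_numBlocks_lt {x y : WeightedPartition n k} (h : Relation.ReflTransGen Cover x y) :
    x = y ∨ y.numBlocks < x.numBlocks := by
  induction h with
  | refl => exact Or.inl rfl
  | tail _ hc ih =>
    rcases ih with rfl | ih
    · exact Or.inr hc.numBlocks_lt
    · exact Or.inr (hc.numBlocks_lt.trans ih)

/-- The order on weighted partitions: `x ≤ y` if there is a finite (possibly empty) sequence of
covers leading from `x` to `y`. -/
instance : PartialOrder (WeightedPartition n k) where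
  le x y := Relation.ReflTransGen Cover x y
  le_refl _ := Relation.ReflTransGen.refl
  le_trans _ _ _ := Relation.ReflTransGen.trans
  le_antisymm x y hxy hyx := by
    rcases eq_or_numBlocks_lt hxy with h | h
    · exact h
    · rcases eq_or_numBlocks_lt hyx with h' | h'
      · exact h'.symm
      · omega

noncomputable instance : DecidableEq (WeightedPartition n k) := Classical.decEq _

noncomputable instance : Fintype (WeightedPartition n k) :=
  Fintype.ofInjective (fun x : WeightedPartition n k => x.layer) fun _ _ h =>
    WeightedPartition.ext h

open Classical in
noncomputable instance : LocallyFiniteOrder (WeightedPartition n k) :=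
  Fintype.toLocallyFiniteOrder

/-- The weighted partition `1/2/⋯/n`: all blocks of the first layer are singletons and all other
layers are empty. -/
def zeroHat (n k : ℕ) [NeZero k] : WeightedPartition n k where
  layer l := if l = 0 then Finset.univ.image fun i => {i} else ∅
  block_nonempty l B hB := by
    split_ifs at hB
    · obtain ⟨i, -, rfl⟩ := mem_image.1 hB
      exact singleton_nonempty i
    · simp at hB
  block_disjoint l B hB C hC hne := by
    split_ifs at hB hC
    · obtain ⟨i, -, rfl⟩ := mem_image.1 hB
      obtain ⟨j, -, rfl⟩ := mem_image.1 hC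
      exact disjoint_singleton.2 fun h => hne (by rw [h])
    · simp at hB
  first_covers i := ⟨{i}, by simp, by simp⟩
  two_le_card l hl B hB := by simp [hl] at hB
  refines l l' h B hB := by
    split_ifs at hB with h'
    · subst h'
      have hl : l = 0 := nonpos_iff_eq_zero.1 h
      exact ⟨B, by simpa [hl] using hB, Subset.rfl⟩
    · simp at hB

/-- The Whitney number of the first kind `w_r^{(n,k)} = ∑ μ(0̂, π)`, the sum being over the weighted
partitions `π` with `r` blocks. -/
noncomputable def whitneyFirst (n k : ℕ) [NeZero k] (r : ℕ) : ℤ :=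
  ∑ π : WeightedPartition n k with π.numBlocks = r, IncidenceAlgebra.mu ℤ (zeroHat n k) π

/-- The characteristic polynomial `∑_{r = 1}^{n} w_r^{(n,k)} x ^ r`. -/
noncomputable def charPoly (n k : ℕ) [NeZero k] : ℤ[X] :=
  ∑ r ∈ Finset.Icc 1 n, C (whitneyFirst n k r) * X ^ r

end WeightedPartition

/-- The (signed) Stirling number of the first kind `s(n, r)`: the coefficient of `x ^ r` in the
falling factorial `x (x - 1) ⋯ (x - n + 1)`. -/
noncomputable def signedStirlingFirst (n r : ℕ) : ℤ := (descPochhammer ℤ n).coeff r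

/-! ### Weighted partitions as families of least-element maps -/

namespace WeightedPartition

variable {n k : ℕ} [NeZero k]

/-! A weighted partition is determined by the maps `least l` that send an element to the minimum of
its block in layer `l`. In these terms a cover redirects the fibre over `b` to the minimum of the
block of `a`, in the layers up to `l` (`cover_iff`).

Increasing forests with edges coloured by layers give weighted partitions: layer `l` consists of the
components formed by the edges of colour at least `l` (`Forest.toPartition`). The crux is that lying
below a given `x` is a condition on each vertex of the forest separately
(`Forest.toPartition_le_iff`). Counting forests with sign `-1` per edge, the total below `x` is
therefore a product over vertices. For `x ≠ 0̂` some vertex has exactly two choices, root or one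
forced edge, whose signs cancel (`Forest.exists_unique_parent`). By the Möbius recursion, `μ(0̂, x)`
is the signed number of forests with partition `x` (`Forest.mu_eq_sum_weight`).

Blocks correspond to roots, so the characteristic polynomial sums, over all forests, `X` per root
and `-1` per edge. A vertex with `j` smaller vertices contributes `X - kj` (`Forest.sum_weight_X`).
-/

theorem mem_blockOf {x : WeightedPartition n k} {l : Fin k} {i j : Fin n} :
    j ∈ x.blockOf l i ↔ j = i ∨ ∃ B ∈ x.layer l, i ∈ B ∧ j ∈ B := by
  simp [blockOf]

theorem mem_blockOf_self (x : WeightedPartition n k) (l : Fin k) (i : Fin n) :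
    i ∈ x.blockOf l i := mem_blockOf.2 (Or.inl rfl)

theorem eq_of_mem_of_mem (x : WeightedPartition n k) {l : Fin k} {B C : Finset (Fin n)}
    (hB : B ∈ x.layer l) (hC : C ∈ x.layer l) {i : Fin n} (hiB : i ∈ B) (hiC : i ∈ C) :
    B = C := by
  by_contra h
  exact Finset.disjoint_left.1 (x.block_disjoint l B hB C hC h) hiB hiC

theorem blockOf_eq_of_mem (x : WeightedPartition n k) {l : Fin k} {B : Finset (Fin n)}
    (hB : B ∈ x.layer l) {i : Fin n} (hi : i ∈ B) : x.blockOf l i = B := by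
  ext j
  rw [mem_blockOf]
  constructor
  · rintro (rfl | ⟨C, hC, hiC, hjC⟩)
    · exact hi
    · exact x.eq_of_mem_of_mem hC hB hiC hi ▸ hjC
  · exact fun hj => Or.inr ⟨B, hB, hi, hj⟩

theorem blockOf_eq_iff_mem {x : WeightedPartition n k} {l : Fin k} {i j : Fin n} :
    x.blockOf l j = x.blockOf l i ↔ j ∈ x.blockOf l i := by
  constructor
  · exact fun h => h ▸ x.mem_blockOf_self l j
  · intro h
    obtain rfl | ⟨B, hB, hi, hj⟩ := mem_blockOf.1 h
    · rfl
    · rw [x.blockOf_eq_of_mem hB hi, x.blockOf_eq_of_mem hB hj]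

theorem blockOf_subset (x : WeightedPartition n k) {l l' : Fin k} (h : l ≤ l') (i : Fin n) :
    x.blockOf l' i ⊆ x.blockOf l i := by
  intro j hj
  obtain rfl | ⟨B, hB, hi, hj⟩ := mem_blockOf.1 hj
  · exact x.mem_blockOf_self l j
  · obtain ⟨C, hC, hBC⟩ := x.refines l l' h B hB
    exact mem_blockOf.2 (Or.inr ⟨C, hC, hBC hi, hBC hj⟩)

/-- `blockOf` adds singletons that deeper layers do not store; the size test removes them, so
`blockOf` determines the layers. -/
theorem mem_layer_iff {x : WeightedPartition n k} {l : Fin k} {B : Finset (Fin n)} :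
    B ∈ x.layer l ↔ (∃ i, x.blockOf l i = B) ∧ (l = 0 ∨ 2 ≤ B.card) := by
  constructor
  · intro hB
    obtain ⟨i, hi⟩ := x.block_nonempty l B hB
    refine ⟨⟨i, x.blockOf_eq_of_mem hB hi⟩, ?_⟩
    by_cases hl : l = 0
    · exact Or.inl hl
    · exact Or.inr (x.two_le_card l hl B hB)
  · rintro ⟨⟨i, rfl⟩, h⟩
    by_cases hex : ∃ B ∈ x.layer l, i ∈ B
    · obtain ⟨B, hB, hi⟩ := hex
      rwa [x.blockOf_eq_of_mem hB hi]
    · have hs : x.blockOf l i = {i} := by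
        ext j
        rw [mem_blockOf, mem_singleton]
        constructor
        · rintro (h | ⟨B, hB, hi, -⟩)
          · exact h
          · exact (hex ⟨B, hB, hi⟩).elim
        · exact Or.inl
      obtain rfl | h := h
      · exact x.blockOf_zero_mem i
      · rw [hs, card_singleton] at h
        omega

theorem ext_blockOf {x y : WeightedPartition n k} (h : ∀ l i, x.blockOf l i = y.blockOf l i) :
    x = y := by
  ext l B
  simp only [mem_layer_iff, h]

/-- The least element of the block of `i` in the `l`-th layer. -/
def least (x : WeightedPartition n k) (l : Fin k) (i : Fin n) : Fin n :=
  (x.blockOf l i).min' ⟨i, x.mem_blockOf_self l i⟩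

theorem least_mem (x : WeightedPartition n k) (l : Fin k) (i : Fin n) :
    x.least l i ∈ x.blockOf l i := min'_mem _ _

theorem least_le_of_mem {x : WeightedPartition n k} {l : Fin k} {i j : Fin n}
    (h : j ∈ x.blockOf l i) : x.least l i ≤ j := min'_le _ _ h

theorem least_le (x : WeightedPartition n k) (l : Fin k) (i : Fin n) : x.least l i ≤ i :=
  least_le_of_mem (x.mem_blockOf_self l i)

theorem least_eq_iff {x : WeightedPartition n k} {l : Fin k} {i j : Fin n} :
    x.least l j = x.least l i ↔ j ∈ x.blockOf l i := by
  rw [← blockOf_eq_iff_mem]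
  constructor
  · intro h
    rw [← blockOf_eq_iff_mem.2 (x.least_mem l i), ← blockOf_eq_iff_mem.2 (x.least_mem l j), h]
  · intro h
    simp only [least, h]

theorem least_least (x : WeightedPartition n k) {l l' : Fin k} (h : l ≤ l') (i : Fin n) :
    x.least l (x.least l' i) = x.least l i :=
  least_eq_iff.2 (x.blockOf_subset h i (x.least_mem l' i))

theorem least_mono (x : WeightedPartition n k) {l l' : Fin k} (h : l ≤ l') (i : Fin n) :
    x.least l i ≤ x.least l' i :=
  least_le_of_mem (x.blockOf_subset h i (x.least_mem l' i))

theorem least_congr (x : WeightedPartition n k) {l l' : Fin k} (h : l ≤ l') {i j : Fin n}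
    (hij : x.least l' i = x.least l' j) : x.least l i = x.least l j := by
  rw [← x.least_least h i, hij, x.least_least h j]

theorem least_eq_self_of_le (x : WeightedPartition n k) {l l' : Fin k} (h : l ≤ l') {i : Fin n}
    (hi : x.least l i = i) : x.least l' i = i :=
  le_antisymm (x.least_le l' i) (hi.ge.trans (x.least_mono h i))

theorem least_eq_self_iff {x : WeightedPartition n k} {l : Fin k} {i : Fin n} :
    x.least l i = i ↔ ∀ j ∈ x.blockOf l i, i ≤ j :=
  ⟨fun h _ hj => h.ge.trans (least_le_of_mem hj),
    fun h => le_antisymm (x.least_le l i) (h _ (x.least_mem l i))⟩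

theorem ext_least {x y : WeightedPartition n k} (h : ∀ l i, x.least l i = y.least l i) :
    x = y := by
  refine ext_blockOf fun l i => ?_
  ext j
  rw [← least_eq_iff, ← least_eq_iff, h, h]

/-- The weighted partition whose blocks in the `l`-th layer are the fibres of `m l`. -/
def ofLeast (m : Fin k → Fin n → Fin n)
    -- The case `l = l'` is idempotence; `l < l'` makes deeper layers refine earlier ones.
    (hm : ∀ l l', l ≤ l' → ∀ i, m l (m l' i) = m l i) : WeightedPartition n k where
  layer l := ((univ : Finset (Fin n)).image fun i => univ.filter fun j => m l j = m l i).filter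
    fun B => l = 0 ∨ 2 ≤ B.card
  block_nonempty l B hB := by
    obtain ⟨i, -, rfl⟩ := mem_image.1 (mem_filter.1 hB).1
    exact ⟨i, by simp⟩
  block_disjoint l B hB C hC hne := by
    obtain ⟨i, -, rfl⟩ := mem_image.1 (mem_filter.1 hB).1
    obtain ⟨j, -, rfl⟩ := mem_image.1 (mem_filter.1 hC).1
    rw [Finset.disjoint_left]
    intro a ha hb
    refine hne ?_
    simp only [mem_filter, mem_univ, true_and] at ha hb
    rw [← ha, ← hb]
  first_covers i := ⟨univ.filter fun j => m 0 j = m 0 i, by simp, by simp⟩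
  two_le_card l hl B hB := (mem_filter.1 hB).2.resolve_left hl
  refines l l' h B hB := by
    obtain ⟨hB, hc⟩ := mem_filter.1 hB
    obtain ⟨i, -, rfl⟩ := mem_image.1 hB
    have hsub : (univ.filter fun j => m l' j = m l' i) ⊆ univ.filter fun j => m l j = m l i := by
      intro j hj
      simp only [mem_filter, mem_univ, true_and] at hj ⊢
      rw [← hm l l' h j, hj, hm l l' h i]
    refine ⟨_, mem_filter.2 ⟨mem_image_of_mem _ (mem_univ i), ?_⟩, hsub⟩
    rcases hc with rfl | hc
    · exact Or.inl (nonpos_iff_eq_zero.1 h)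
    · exact Or.inr (hc.trans (card_le_card hsub))

theorem mem_blockOf_ofLeast {m : Fin k → Fin n → Fin n}
    (hm : ∀ l l', l ≤ l' → ∀ i, m l (m l' i) = m l i) {l : Fin k} {i j : Fin n} :
    j ∈ (ofLeast m hm).blockOf l i ↔ m l j = m l i := by
  rw [mem_blockOf]
  constructor
  · rintro (rfl | ⟨B, hB, hi, hj⟩)
    · rfl
    · obtain ⟨a, -, rfl⟩ := mem_image.1 (mem_filter.1 hB).1
      simp only [mem_filter, mem_univ, true_and] at hi hj
      rw [hi, hj]
  · intro h
    by_cases hij : j = i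
    · exact Or.inl hij
    · refine Or.inr ⟨_, mem_filter.2 ⟨mem_image_of_mem _ (mem_univ i), Or.inr ?_⟩,
        by simp, by simpa using h⟩
      exact Finset.one_lt_card.2 ⟨i, by simp, j, by simpa using h, Ne.symm hij⟩

theorem least_ofLeast {m : Fin k → Fin n → Fin n}
    (hm : ∀ l l', l ≤ l' → ∀ i, m l (m l' i) = m l i) (hle : ∀ l i, m l i ≤ i)
    (l : Fin k) (i : Fin n) : (ofLeast m hm).least l i = m l i := by
  refine le_antisymm (least_le_of_mem ((mem_blockOf_ofLeast hm).2 (hm l l le_rfl i))) ?_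
  rw [← (mem_blockOf_ofLeast hm).1 ((ofLeast m hm).least_mem l i)]
  exact hle _ _

theorem least_zeroHat (l : Fin k) (i : Fin n) : (zeroHat n k).least l i = i := by
  have h := (zeroHat n k).least_mem l i
  rw [mem_blockOf] at h
  rcases h with h | ⟨B, hB, hi, hj⟩
  · exact h
  · simp only [zeroHat] at hB
    split_ifs at hB
    · obtain ⟨a, -, rfl⟩ := mem_image.1 hB
      rw [mem_singleton.1 hj, mem_singleton.1 hi]
    · simp at hB

theorem eq_zeroHat {x : WeightedPartition n k} (h : ∀ i, x.least 0 i = i) : x = zeroHat n k :=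
  ext_least fun l i => by
    rw [least_zeroHat, x.least_eq_self_of_le (Fin.zero_le l) (h i)]

theorem numBlocks_eq_card (x : WeightedPartition n k) :
    x.numBlocks = (univ.filter fun i => x.least 0 i = i).card := by
  symm
  refine card_bij (fun i _ => x.blockOf 0 i) (fun i _ => x.blockOf_zero_mem i) ?_ ?_
  · intro i hi j hj h
    simp only [mem_filter, mem_univ, true_and] at hi hj
    rw [← hi, ← hj]
    exact least_eq_iff.2 (blockOf_eq_iff_mem.1 h)
  · intro B hB
    obtain ⟨i, rfl⟩ := (mem_layer_iff.1 hB).1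
    exact ⟨x.least 0 i, by simp [x.least_least le_rfl], blockOf_eq_iff_mem.2 (x.least_mem 0 i)⟩

/-! ### The cover relation in terms of least elements -/

/-- `y` arises from `x` by merging the blocks of `a` and `b` in the layers up to `l`. -/
def Merge (x y : WeightedPartition n k) (a b : Fin n) (l : Fin k) : Prop :=
  ∀ l' i, y.least l' i =
    if l' ≤ l ∧ x.least l' i = b then x.least l' a else x.least l' i

/-- A block minimum in the first layer stays one in every deeper layer, and `a < b` cannot share a
block whose minimum is `b`; the other clauses are automatic. -/
theorem admissible_iff {x : WeightedPartition n k} {a b : Fin n} {l : Fin k} :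
    x.Admissible a b l ↔ a < b ∧ x.least 0 b = b ∧ x.least l a = a := by
  constructor
  · rintro ⟨hab, ⟨-, hb⟩, -, ha, -⟩
    exact ⟨hab, least_eq_self_iff.2 hb, least_eq_self_iff.2 ha⟩
  · rintro ⟨hab, hb, ha⟩
    have hbl := x.least_eq_self_of_le (Fin.zero_le l) hb
    have key : ∀ l', x.least l' b = b → x.blockOf l' a ≠ x.blockOf l' b := by
      intro l' hl' h
      have := x.least_le l' a
      rw [least_eq_iff.2 (blockOf_eq_iff_mem.1 h), hl'] at this
      exact absurd hab (not_lt.2 this)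
    exact ⟨hab, ⟨key 0 hb, least_eq_self_iff.1 hb⟩, key l hbl, least_eq_self_iff.1 ha,
      least_eq_self_iff.1 hbl⟩

/-- The family of blocks with the blocks of `a` and `b` replaced by their union in the layers up
to `l`. -/
def mergedLayer (x : WeightedPartition n k) (a b : Fin n) (l l' : Fin k) :
    Finset (Finset (Fin n)) :=
  if l' ≤ l then
    insert (x.blockOf l' a ∪ x.blockOf l' b)
      (((x.layer l').erase (x.blockOf l' a)).erase (x.blockOf l' b))
  else x.layer l'

theorem mem_blockOf_of_layer_eq {x y : WeightedPartition n k} {a b : Fin n} {l : Fin k}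
    (h : ∀ l', y.layer l' = x.mergedLayer a b l l') {l' : Fin k} (hl : l' ≤ l) {i j : Fin n} :
    j ∈ y.blockOf l' i ↔ j ∈ x.blockOf l' i ∨
      ((i ∈ x.blockOf l' a ∨ i ∈ x.blockOf l' b) ∧ (j ∈ x.blockOf l' a ∨ j ∈ x.blockOf l' b)) := by
  have hlay := h l'
  rw [mergedLayer, if_pos hl] at hlay
  rw [mem_blockOf, hlay]
  constructor
  · rintro (rfl | ⟨B, hB, hi, hj⟩)
    · exact Or.inl (x.mem_blockOf_self l' j)
    · rcases mem_insert.1 hB with rfl | hB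
      · exact Or.inr ⟨mem_union.1 hi, mem_union.1 hj⟩
      · have hB := mem_of_mem_erase (mem_of_mem_erase hB)
        exact Or.inl (by rwa [x.blockOf_eq_of_mem hB hi])
  · rintro (hj | ⟨hi, hj⟩)
    · by_cases hij : i ∈ x.blockOf l' a ∪ x.blockOf l' b
      · refine Or.inr ⟨_, mem_insert_self _ _, hij, ?_⟩
        rw [mem_union] at hij ⊢
        rcases hij with hi | hi <;> rw [← blockOf_eq_iff_mem.2 hi]
        · exact Or.inl hj
        · exact Or.inr hj
      · obtain hj | ⟨B, hB, hi, hj⟩ := mem_blockOf.1 hj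
        · exact Or.inl hj
        · refine Or.inr ⟨B, mem_insert_of_mem (mem_erase.2 ⟨?_, mem_erase.2 ⟨?_, hB⟩⟩), hi, hj⟩
          · rintro rfl
            exact hij (mem_union_right _ hi)
          · rintro rfl
            exact hij (mem_union_left _ hi)
    · exact Or.inr ⟨_, mem_insert_self _ _, mem_union.2 hi, mem_union.2 hj⟩

theorem mem_blockOf_of_merge {x y : WeightedPartition n k} {a b : Fin n} {l : Fin k}
    (hab : a < b) (hb : x.least 0 b = b) (h : Merge x y a b l)
    {l' : Fin k} (hl : l' ≤ l) {i j : Fin n} :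
    j ∈ y.blockOf l' i ↔ j ∈ x.blockOf l' i ∨
      ((i ∈ x.blockOf l' a ∨ i ∈ x.blockOf l' b) ∧ (j ∈ x.blockOf l' a ∨ j ∈ x.blockOf l' b)) := by
  have hb' := x.least_eq_self_of_le (Fin.zero_le l') hb
  have ha : x.least l' a ≠ b := ((x.least_le l' a).trans_lt hab).ne
  simp only [← least_eq_iff, h l', hl, true_and, hb']
  split_ifs <;> grind

theorem merge_of_layer_eq {x y : WeightedPartition n k} {a b : Fin n} {l : Fin k}
    (hab : a < b) (hb : x.least 0 b = b) (h : ∀ l', y.layer l' = x.mergedLayer a b l l') :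
    Merge x y a b l := by
  intro l' i
  by_cases hl : l' ≤ l
  · have hb' := x.least_eq_self_of_le (Fin.zero_le l') hb
    have hale : x.least l' a < b := (x.least_le l' a).trans_lt hab
    have key := @mem_blockOf_of_layer_eq n k _ x y a b l h l' hl
    -- Squeeze `y.least l' i`: `h1` with `e1` bounds it below, while `e2` and `e3` bound it above by
    -- elements of its block.
    have h1 := key.1 (y.least_mem l' i)
    have hge : ∀ j, j ∈ y.blockOf l' i → y.least l' i ≤ j := fun j => least_le_of_mem
    have e1 := x.least_le l' (y.least l' i)
    have e2 := hge (x.least l' i) (key.2 (Or.inl (x.least_mem l' i)))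
    have e3 := fun h => hge (x.least l' a) (key.2 (Or.inr h))
    have e4 := x.least_least (le_refl l') a
    simp only [← least_eq_iff, hb', hl, true_and] at h1 e3 ⊢
    split_ifs with hc
    · have := e3 ⟨Or.inr hc, Or.inl e4⟩
      grind
    · grind
  · have hlay := h l'
    rw [mergedLayer, if_neg hl] at hlay
    simp [hl, least, blockOf, hlay]

theorem layer_eq_of_merge {x y : WeightedPartition n k} {a b : Fin n} {l : Fin k}
    (hab : a < b) (hb : x.least 0 b = b) (h : Merge x y a b l) (l' : Fin k) :
    y.layer l' = x.mergedLayer a b l l' := by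
  by_cases hl : l' ≤ l
  · have key := @mem_blockOf_of_merge n k _ x y a b l hab hb h l' hl
    have hu : ∀ i, i ∈ x.blockOf l' a ∪ x.blockOf l' b →
        y.blockOf l' i = x.blockOf l' a ∪ x.blockOf l' b := by
      intro i hi
      ext j
      rw [key, mem_union]
      refine ⟨?_, fun hj => Or.inr ⟨mem_union.1 hi, hj⟩⟩
      rintro (hj | ⟨-, hj⟩)
      · rcases mem_union.1 hi with hi | hi <;> rw [← blockOf_eq_iff_mem.2 hi]
        · exact Or.inl hj
        · exact Or.inr hj
      · exact hj
    have hn : ∀ i, i ∉ x.blockOf l' a ∪ x.blockOf l' b → y.blockOf l' i = x.blockOf l' i := by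
      intro i hi
      ext j
      rw [key]
      refine ⟨?_, Or.inl⟩
      rintro (hj | ⟨hi', -⟩)
      · exact hj
      · exact (hi (mem_union.2 hi')).elim
    ext B
    rw [mergedLayer, if_pos hl, mem_insert, mem_layer_iff, mem_erase, mem_erase, mem_layer_iff]
    constructor
    · rintro ⟨⟨i, rfl⟩, hc⟩
      by_cases hi : i ∈ x.blockOf l' a ∪ x.blockOf l' b
      · exact Or.inl (hu i hi)
      · rw [hn i hi] at hc ⊢
        refine Or.inr ⟨?_, ?_, ⟨i, rfl⟩, hc⟩ <;> intro he <;> apply hi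
        · exact mem_union_right _ (blockOf_eq_iff_mem.1 he)
        · exact mem_union_left _ (blockOf_eq_iff_mem.1 he)
    · rintro (rfl | ⟨hBb, hBa, ⟨i, rfl⟩, hc⟩)
      · refine ⟨⟨a, hu a (mem_union_left _ (x.mem_blockOf_self l' a))⟩, Or.inr ?_⟩
        -- The union contains both `a` and `b`, so it passes the size test in every layer.
        exact Finset.one_lt_card.2 ⟨a, mem_union_left _ (x.mem_blockOf_self l' a), b,
          mem_union_right _ (x.mem_blockOf_self l' b), hab.ne⟩
      · refine ⟨⟨i, hn i fun hi => ?_⟩, hc⟩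
        rcases mem_union.1 hi with hi | hi
        · exact hBa (blockOf_eq_iff_mem.2 hi)
        · exact hBb (blockOf_eq_iff_mem.2 hi)
  · rw [mergedLayer, if_neg hl]
    ext B
    have hbl : ∀ i, y.blockOf l' i = x.blockOf l' i := by
      intro i
      ext j
      rw [← least_eq_iff, ← least_eq_iff, h, h]
      simp [hl]
    simp only [mem_layer_iff, hbl]

theorem cover_iff {x y : WeightedPartition n k} :
    Cover x y ↔ ∃ (a b : Fin n) (l : Fin k),
      (a < b ∧ x.least 0 b = b ∧ x.least l a = a) ∧ Merge x y a b l := by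
  constructor
  · rintro ⟨a, b, l, hadm, h⟩
    have hadm := admissible_iff.1 hadm
    exact ⟨a, b, l, hadm, merge_of_layer_eq hadm.1 hadm.2.1 h⟩
  · rintro ⟨a, b, l, hadm, h⟩
    exact ⟨a, b, l, admissible_iff.2 hadm, layer_eq_of_merge hadm.1 hadm.2.1 h⟩

end WeightedPartition

/-! ### Increasing coloured forests -/

namespace WeightedPartition

section

variable {n k : ℕ}

/-- An increasing forest on `Fin n` with edges coloured by `Fin k`: each vertex is a root or has a
smaller parent and a colour of the edge leading to it. -/
abbrev Forest (n k : ℕ) : Type := (b : Fin n) → Option ({a : Fin n // a < b} × Fin k)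

namespace Forest

/-- The root of the component of `b` in the subforest of the edges with colours at least `l`. -/
def root (F : Forest n k) (l : Fin k) (b : Fin n) : Fin n :=
  match F b with
  | none => b
  | some (a, c) => if l ≤ c then root F l a.1 else b
termination_by b
decreasing_by exact a.2

theorem root_of_none {F : Forest n k} {b : Fin n} (h : F b = none) (l : Fin k) :
    F.root l b = b := by
  rw [root]
  simp [h]

theorem root_of_some {F : Forest n k} {b : Fin n} {a : {a : Fin n // a < b}} {c : Fin k}
    (h : F b = some (a, c)) (l : Fin k) :
    F.root l b = if l ≤ c then F.root l a.1 else b := by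
  rw [root]
  simp [h]

theorem root_le (F : Forest n k) (l : Fin k) (b : Fin n) : F.root l b ≤ b := by
  induction b using WellFoundedLT.induction with
  | _ b ih =>
    rcases h : F b with _ | ⟨a, c⟩
    · rw [root_of_none h]
    · rw [root_of_some h]
      split_ifs
      · exact (ih a.1 a.2).trans a.2.le
      · exact le_rfl

theorem root_root (F : Forest n k) (l l' : Fin k) (hl : l ≤ l') (b : Fin n) :
    F.root l (F.root l' b) = F.root l b := by
  induction b using WellFoundedLT.induction with
  | _ b ih =>
    rcases h : F b with _ | ⟨a, c⟩
    · rw [root_of_none h l']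
    · rw [root_of_some h l']
      split_ifs with hc
      · rw [ih a.1 a.2, root_of_some h, if_pos (hl.trans hc)]
      · rfl

/-- Parents are smaller than their children, so a new edge at `b` does not affect the vertices below
`b`. The formula has the shape of `Merge`. -/
theorem root_update {F : Forest n k} {b : Fin n} (hb : F b = none) (a : {a : Fin n // a < b})
    (c l : Fin k) (i : Fin n) :
    root (Function.update F b (some (a, c))) l i =
      if l ≤ c ∧ F.root l i = b then F.root l a.1 else F.root l i := by
  set G : Forest n k := Function.update F b (some (a, c)) with hG
  have hGne : ∀ i, i ≠ b → G i = F i := fun i hi => by rw [hG, Function.update_of_ne hi]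
  have hlt : ∀ i, i < b → ∀ l, G.root l i = F.root l i := by
    intro i
    induction i using WellFoundedLT.induction with
    | _ i ih =>
      intro hi l
      have := hGne i hi.ne
      rcases h : F i with _ | ⟨a', c'⟩
      · rw [root_of_none h, root_of_none (this.trans h)]
      · rw [root_of_some h, root_of_some (this.trans h), ih a'.1 a'.2 (a'.2.trans hi)]
  induction i using WellFoundedLT.induction with
  | _ i ih =>
    by_cases hi : i = b
    · subst hi
      have h : G i = some (a, c) := by rw [hG, Function.update_self]
      rw [root_of_some h, root_of_none hb, hlt a.1 a.2]
      simp
    · have := hGne i hi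
      rcases h : F i with _ | ⟨a', c'⟩
      · rw [root_of_none h, root_of_none (this.trans h)]
        simp [hi]
      · rw [root_of_some h, root_of_some (this.trans h), ih a'.1 a'.2]
        split_ifs <;> simp_all

/-- The product of a factor `t` for each root and a factor `-1` for each edge. -/
def weight {R : Type*} [CommRing R] (t : R) (F : Forest n k) : R :=
  ∏ b, (F b).elim t fun _ => -1

theorem sum_weight_X : ∑ F : Forest n k, F.weight (X : ℤ[X]) =
    ∏ j ∈ range n, (X - C ((k : ℤ) * (j : ℤ))) := by
  have h := prod_univ_sum
    (fun b : Fin n => (univ : Finset (Option ({a : Fin n // a < b} × Fin k))))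
    (fun _ o => o.elim (X : ℤ[X]) fun _ => -1)
  rw [Fintype.piFinset_univ] at h
  refine h.symm.trans ?_
  rw [← Fin.prod_univ_eq_prod_range (fun j => X - C ((k : ℤ) * (j : ℤ)))]
  refine prod_congr rfl fun b _ => ?_
  rw [Fintype.sum_option]
  -- Indices start at `0`, so vertex `b` has `b` possible parents, each with `k` colours.
  have hcard : Fintype.card {a : Fin n // a < b} = b := by
    rw [Fintype.card_subtype, ← Fin.card_Iio b]
    congr 1
    ext a
    simp
  simp [Fintype.card_prod, hcard, mul_comm, sub_eq_add_neg]

end Forest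

end

/-! ### Forests below a weighted partition -/

variable {n k : ℕ} [NeZero k]

namespace Forest

/-- The weighted partition into the components of the subforests of edges of colour at least
`l`. -/
def toPartition (F : Forest n k) : WeightedPartition n k := ofLeast F.root F.root_root

theorem least_toPartition (F : Forest n k) (l : Fin k) (b : Fin n) :
    F.toPartition.least l b = F.root l b := least_ofLeast _ F.root_le l b

theorem root_eq_self_iff {F : Forest n k} {b : Fin n} : F.root 0 b = b ↔ F b = none := by
  refine ⟨fun h => ?_, fun h => root_of_none h 0⟩
  rcases hF : F b with _ | ⟨a, c⟩
  · rfl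
  · rw [root_of_some hF, if_pos (Fin.zero_le c)] at h
    exact absurd a.2 (not_lt.2 (h.ge.trans (F.root_le 0 a.1)))

/-- Joining `b` to `o` is compatible with the weighted partition `x`: if `o` is a parent `a` with
colour `l`, then `l` is the deepest layer in which `b` is not the least element of its block, and
`a` lies in that block. -/
def CompatibleAt (x : WeightedPartition n k) (b : Fin n)
    (o : Option ({a : Fin n // a < b} × Fin k)) : Prop :=
  ∀ p ∈ o, x.least p.2 p.1.1 = x.least p.2 b ∧ ∀ l, p.2 < l → x.least l b = b

/-- Every edge of the forest is compatible with `x`. -/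
def Compatible (F : Forest n k) (x : WeightedPartition n k) : Prop :=
  ∀ b, CompatibleAt x b (F b)

theorem compatible_toPartition (F : Forest n k) : F.Compatible F.toPartition := by
  rintro b ⟨a, c⟩ h
  rw [Option.mem_def] at h
  simp only [least_toPartition]
  refine ⟨by rw [root_of_some h, if_pos le_rfl], fun l hl => ?_⟩
  rw [root_of_some h, if_neg (not_le.2 hl)]

theorem Compatible.of_cover {F : Forest n k} {x y : WeightedPartition n k} (h : F.Compatible x)
    (hxy : Cover x y) : F.Compatible y := by
  obtain ⟨a, b, l, ⟨-, hb, -⟩, hm⟩ := cover_iff.1 hxy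
  rintro b' ⟨a', c⟩ hF
  obtain ⟨h1, h2⟩ := h b' _ hF
  simp only at h1 h2 ⊢
  refine ⟨by rw [hm, hm, h1], fun l' hl' => ?_⟩
  rw [hm, h2 l' hl', if_neg]
  rintro ⟨-, rfl⟩
  -- If `b'` were the merged `b`, it would be minimal in its first-layer block, which contains its
  -- smaller parent `a'`.
  have h0 := x.least_congr (Fin.zero_le c) h1
  rw [hb] at h0
  exact absurd a'.2 (not_lt.2 (h0.ge.trans (x.least_le 0 a'.1)))

theorem Compatible.mono {F : Forest n k} {x y : WeightedPartition n k} (h : F.Compatible x)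
    (hxy : x ≤ y) : F.Compatible y := by
  change Relation.ReflTransGen Cover x y at hxy
  induction hxy with
  | refl => exact h
  | tail _ hc ih => exact ih.of_cover hc

theorem root_eq_least {F : Forest n k} {x : WeightedPartition n k} (h : F.Compatible x)
    (hF : ∀ b, F b = none → x.least 0 b = b) (l : Fin k) (b : Fin n) :
    F.root l b = x.least l b := by
  induction b using WellFoundedLT.induction with
  | _ b ih =>
    rcases hb : F b with _ | ⟨a, c⟩
    · rw [root_of_none hb, x.least_eq_self_of_le (Fin.zero_le l) (hF b hb)]
    · obtain ⟨h1, h2⟩ := h b _ hb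
      rw [root_of_some hb]
      split_ifs with hc
      · rw [ih a.1 a.2]
        exact x.least_congr hc h1
      · exact (h2 l (not_le.1 hc)).symm

theorem cover_update {F : Forest n k} {b : Fin n} (hb : F b = none) (a : {a : Fin n // a < b})
    (c : Fin k) (ha : F.root c a.1 = a.1) :
    Cover F.toPartition (toPartition (Function.update F b (some (a, c)))) := by
  refine cover_iff.2 ⟨a.1, b, c, ⟨a.2, ?_, ?_⟩, fun l i => ?_⟩
  · rw [least_toPartition, root_of_none hb]
  · rw [least_toPartition, ha]
  · simp only [least_toPartition, root_update hb]

/-- The deepest layer in which `b` is not the least element of its block. -/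
theorem exists_deepest {x : WeightedPartition n k} {b : Fin n} (hb : x.least 0 b ≠ b) :
    ∃ c, x.least c b ≠ b ∧ ∀ l, c < l → x.least l b = b := by
  have hne : (univ.filter fun l => x.least l b ≠ b).Nonempty := ⟨0, by simpa using hb⟩
  refine ⟨_, (mem_filter.1 (max'_mem _ hne)).2, fun l hl => ?_⟩
  by_contra h
  exact absurd (le_max' _ l (by simpa using h)) (not_le.2 hl)

/-- Induction on the number of roots. If every root is a first-layer minimum of `x`, the forest
already yields `x`; otherwise an edge can be added at a superfluous root, which is a cover and
preserves compatibility. -/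
theorem Compatible.toPartition_le {x : WeightedPartition n k} (F : Forest n k)
    (h : F.Compatible x) : F.toPartition ≤ x := by
  by_cases hF : ∀ b, F b = none → x.least 0 b = b
  · refine (ext_least fun l b => ?_).le
    rw [least_toPartition, root_eq_least h hF]
  · push Not at hF
    obtain ⟨b, hb, hne⟩ := hF
    obtain ⟨c, hc, hdeep⟩ := exists_deepest hne
    have hlt : x.least c b < b := lt_of_le_of_ne (x.least_le c b) hc
    -- A parent edge of colour at least `c` would lead to a smaller element of the same layer-`c`
    -- block.
    have hroot : F.root c (x.least c b) = x.least c b := by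
      rcases hF : F (x.least c b) with _ | ⟨a, c'⟩
      · exact root_of_none hF c
      · rw [root_of_some hF, if_neg]
        intro hcc
        have h1 := x.least_congr hcc (h _ _ hF).1
        simp only [x.least_least le_rfl] at h1
        exact absurd a.2 (not_lt.2 (h1.ge.trans (x.least_le c a.1)))
    have hcomp : Compatible (Function.update F b (some (⟨x.least c b, hlt⟩, c))) x := by
      intro i
      by_cases hi : i = b
      · subst hi
        rw [Function.update_self]
        rintro p hp
        rw [Option.mem_some_iff] at hp
        subst hp
        exact ⟨x.least_least le_rfl i, hdeep⟩
      · rw [Function.update_of_ne hi]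
        exact h i
    have hdec : (univ.filter fun i => (Function.update F b (some (⟨x.least c b, hlt⟩, c))) i
        = none).card < (univ.filter fun i => F i = none).card := by
      refine card_lt_card ⟨fun i hi => ?_, fun hs => ?_⟩
      · by_cases hib : i = b
        · subst hib
          simpa using hb
        · simpa [Function.update_of_ne hib] using hi
      · simpa using hs (mem_filter.2 ⟨mem_univ b, hb⟩)
    exact Relation.ReflTransGen.head (cover_update hb ⟨_, hlt⟩ c hroot)
      (Compatible.toPartition_le _ hcomp)
termination_by (univ.filter fun i => F i = none).card
decreasing_by exact hdec

theorem toPartition_le_iff {F : Forest n k} {x : WeightedPartition n k} :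
    F.toPartition ≤ x ↔ F.Compatible x :=
  ⟨fun h => F.compatible_toPartition.mono h, Compatible.toPartition_le F⟩

theorem zeroHat_le (x : WeightedPartition n k) : zeroHat n k ≤ x := by
  have h : Compatible (fun _ => none : Forest n k) x := fun b p hp => by simp at hp
  convert! Compatible.toPartition_le _ h
  exact (eq_zeroHat fun i => by rw [least_toPartition, root_of_none rfl]).symm

theorem numBlocks_toPartition (F : Forest n k) :
    F.toPartition.numBlocks = (univ.filter fun b => F b = none).card := by
  simp only [numBlocks_eq_card, least_toPartition, root_eq_self_iff]

/-- Below `x ≠ 0̂` some vertex has exactly one compatible parent edge. -/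
theorem exists_unique_parent {x : WeightedPartition n k} (hx : x ≠ zeroHat n k) :
    ∃ b, ∃ p, CompatibleAt x b (some p) ∧ ∀ q, CompatibleAt x b (some q) → q = p := by
  have hex : ∃ b, x.least 0 b ≠ b := by
    by_contra! h
    exact hx (eq_zeroHat h)
  -- Take the smallest `b` that is not a first-layer minimum. All smaller vertices are minima in
  -- every layer, so once the colour is forced the parent can only be the block minimum.
  obtain ⟨b, hb, hmin⟩ := WellFounded.has_min (wellFounded_lt (α := Fin n))
    {b | x.least 0 b ≠ b} hex
  have hfix : ∀ a, a < b → x.least 0 a = a := fun a ha => by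
    by_contra h
    exact hmin a h ha
  obtain ⟨c, hc, hdeep⟩ := exists_deepest hb
  have hlt : x.least c b < b := lt_of_le_of_ne (x.least_le c b) hc
  refine ⟨b, (⟨x.least c b, hlt⟩, c), ?_, ?_⟩
  · intro p hp
    rw [Option.mem_some_iff] at hp
    subst hp
    exact ⟨x.least_least le_rfl b, hdeep⟩
  · rintro ⟨a, c'⟩ hq
    obtain ⟨h1, h2⟩ := hq _ (Option.mem_some_iff.2 rfl)
    simp only at h1 h2
    have hcc : c' = c := by
      rcases lt_trichotomy c' c with h | h | h
      · exact (hc (h2 c h)).elim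
      · exact h
      · have := hdeep c' h
        rw [this] at h1
        exact absurd a.2 (not_lt.2 (h1.ge.trans (x.least_le c' a.1)))
    subst hcc
    have h3 := x.least_eq_self_of_le (Fin.zero_le c') (hfix a.1 a.2)
    rw [h3] at h1
    exact Prod.ext (Subtype.ext h1) rfl

/-! ### The Möbius function as a signed count of forests -/

open Classical in
theorem sum_weight_compatible {x : WeightedPartition n k} (hx : x ≠ zeroHat n k) :
    ∑ F : Forest n k with F.Compatible x, F.weight (1 : ℤ) = 0 := by
  have hset : (univ.filter fun F : Forest n k => F.Compatible x) =
      Fintype.piFinset fun b => univ.filter fun o => CompatibleAt x b o := by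
    ext F
    rw [mem_filter, Fintype.mem_piFinset]
    simp only [mem_univ, true_and, mem_filter, Compatible]
  simp only [hset, weight]
  rw [← prod_univ_sum (fun b => univ.filter fun o => CompatibleAt x b o)
    (fun _ o => o.elim (1 : ℤ) fun _ => -1)]
  obtain ⟨b, p, hp, huniq⟩ := exists_unique_parent hx
  refine prod_eq_zero (mem_univ b) ?_
  have hb : (univ.filter fun o => CompatibleAt x b o) = {none, some p} := by
    ext o
    rcases o with _ | q
    · simp [CompatibleAt]
    · simp only [mem_filter, mem_univ, true_and, mem_insert, reduceCtorEq, false_or,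
        mem_singleton, Option.some.injEq]
      exact ⟨huniq q, fun h => h ▸ hp⟩
  -- The factor at `b` is `1 + (-1)`: root or its only compatible edge.
  rw [hb, sum_pair (by simp)]
  simp

open Classical in
-- The forest sums satisfy the recursion defining `μ(0̂, ·)`: summed over `[0̂, x]` they vanish for
-- `x ≠ 0̂`, and only the edgeless forest gives `0̂`.
theorem mu_eq_sum_weight (x : WeightedPartition n k) :
    IncidenceAlgebra.mu ℤ (zeroHat n k) x =
      ∑ F : Forest n k with F.toPartition = x, F.weight (1 : ℤ) := by
  induction x using WellFoundedLT.induction with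
  | _ x ih =>
    have hle : ∑ y ∈ Icc (zeroHat n k) x, ∑ F : Forest n k with F.toPartition = y,
        F.weight (1 : ℤ) = ∑ F : Forest n k with F.Compatible x, F.weight (1 : ℤ) := by
      rw [← sum_fiberwise_of_maps_to (g := toPartition) (t := Icc (zeroHat n k) x)]
      · refine sum_congr rfl fun y hy => sum_congr ?_ fun _ _ => rfl
        ext F
        simp only [mem_filter, mem_univ, true_and, ← toPartition_le_iff]
        exact ⟨fun h => ⟨h ▸ (mem_Icc.1 hy).2, h⟩, fun h => h.2⟩
      · intro F hF
        exact mem_Icc.2 ⟨zeroHat_le _, toPartition_le_iff.2 (mem_filter.1 hF).2⟩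
    by_cases hx : x = zeroHat n k
    · subst hx
      have hone : (univ.filter fun F : Forest n k => F.toPartition = zeroHat n k) =
          {fun _ => none} := by
        ext F
        simp only [mem_filter, mem_univ, true_and, mem_singleton]
        constructor
        · intro h
          funext b
          rw [← root_eq_self_iff, ← least_toPartition, h, least_zeroHat]
        · rintro rfl
          exact eq_zeroHat fun i => by rw [least_toPartition, root_of_none rfl]
      simp [hone, weight]
    · rw [sum_weight_compatible hx, ← Ico_insert_right (zeroHat_le x),
        sum_insert right_notMem_Ico] at hle
      rw [IncidenceAlgebra.mu_eq_neg_sum_Ico_of_ne (Ne.symm hx), eq_comm,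
        ← add_eq_zero_iff_eq_neg, ← hle]
      congr 1
      exact sum_congr rfl fun y hy => ih y (mem_Ico.1 hy).2

theorem weight_eq (F : Forest n k) :
    F.weight (X : ℤ[X]) = C (F.weight (1 : ℤ)) * X ^ F.toPartition.numBlocks := by
  rw [numBlocks_toPartition, weight, weight, map_prod, ← prod_const, prod_filter,
    ← prod_mul_distrib]
  refine prod_congr rfl fun b _ => ?_
  rcases F b with _ | p <;> simp

end Forest

/-! ### The characteristic polynomial and its coefficients -/

theorem numBlocks_mem_Icc (hn : 1 ≤ n) (x : WeightedPartition n k) :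
    x.numBlocks ∈ Icc 1 n := by
  rw [mem_Icc]
  constructor
  · exact card_pos.2 ⟨_, x.blockOf_zero_mem ⟨0, hn⟩⟩
  · rw [numBlocks_eq_card]
    exact (card_filter_le _ _).trans (by simp)

theorem charPoly_eq_sum_mu (hn : 1 ≤ n) :
    charPoly n k = ∑ x : WeightedPartition n k,
      C (IncidenceAlgebra.mu ℤ (zeroHat n k) x) * X ^ x.numBlocks := by
  rw [charPoly, ← sum_fiberwise_of_maps_to (g := numBlocks) (t := Icc 1 n)
    fun x _ => numBlocks_mem_Icc hn x]
  refine sum_congr rfl fun r _ => ?_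
  rw [whitneyFirst, map_sum, sum_mul]
  exact sum_congr rfl fun x hx => by rw [(mem_filter.1 hx).2]

theorem charPoly_eq_prod (hn : 1 ≤ n) :
    charPoly n k = ∏ j ∈ range n, (X - C ((k : ℤ) * (j : ℤ))) := by
  classical
  rw [charPoly_eq_sum_mu hn, ← Forest.sum_weight_X,
    ← sum_fiberwise_of_maps_to (g := Forest.toPartition) (t := univ) fun F _ => mem_univ _]
  refine sum_congr rfl fun x _ => ?_
  rw [Forest.mu_eq_sum_weight, map_sum, sum_mul]
  refine sum_congr ?_ fun F hF => ?_
  · ext F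
    simp
  · rw [Forest.weight_eq, (mem_filter.1 hF).2]

theorem coeff_charPoly {r : ℕ} (h1 : 1 ≤ r) (hr : r ≤ n) :
    (charPoly n k).coeff r = whitneyFirst n k r := by
  rw [charPoly, finsetSum_coeff, sum_eq_single_of_mem r (mem_Icc.2 ⟨h1, hr⟩)]
  · simp
  · intro s _ hs
    simp [coeff_X_pow, hs.symm]

end WeightedPartition

/-- Scaling roots by `c` multiplies the coefficient of `X ^ r` by `c ^ (n - r)`, which turns the
product formula into the Stirling number formula. -/
theorem scaleRoots_descPochhammer (n : ℕ) (c : ℤ) :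
    (descPochhammer ℤ n).scaleRoots c = ∏ j ∈ Finset.range n, (X - C (c * (j : ℤ))) := by
  induction n with
  | zero => simp
  | succ n ih =>
    have h := X_add_C_scaleRoots (-(n : ℤ)) c
    rw [Finset.prod_range_succ, ← ih, descPochhammer_succ_right,
      mul_scaleRoots_of_noZeroDivisors]
    congr 1
    simpa [sub_eq_add_neg, mul_comm] using h

theorem mainTheorem3 (n k : ℕ) [NeZero k] (hn : 1 ≤ n) :
    WeightedPartition.charPoly n k = ∏ j ∈ Finset.range n, (X - C ((k : ℤ) * (j : ℤ))) ∧
      ∀ r : ℕ, 1 ≤ r → r ≤ n →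
        WeightedPartition.whitneyFirst n k r =
          (k : ℤ) ^ (n - r) * signedStirlingFirst n r := by
  refine ⟨WeightedPartition.charPoly_eq_prod hn, fun r h1 hr => ?_⟩
  rw [← WeightedPartition.coeff_charPoly h1 hr, WeightedPartition.charPoly_eq_prod hn,
    ← scaleRoots_descPochhammer, coeff_scaleRoots, descPochhammer_natDegree, mul_comm,
    signedStirlingFirst]
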